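/- Let $0<p<1$, $q=1-p$ and $p\neq q$. For each $n\ge 0$ let $x_1,\dots,x_n$ be independent random digits with $P(x_i=0)=p$ and $P(x_i=1)=q$, and let $$S=\#\{(i,j): i>j,\ x_i>x_j\}-\#\{(i,j): i>j,\ x_i<x_j\}.$$ Write $\mu_r(n)=\mathbb E[S^r]$, and let $\sigma(n)=\sqrt{\operatorname{Var}(S)}$ be the standard deviation of $S$. Then: (i) $\mu_{2k+1}(n)=0$ for all $n,k\ge 0$ (in particular $S$ has mean $0$, so the $\mu_r(n)$ are also the central moments and $\sigma(n)^2=\mu_2(n)$); (ii) for every $k\ge 0$, $$\lim_{n\to\infty}\frac{\mu_{2k}(n)}{\sigma(n)^{2k}}=\frac{(2k)!}{2^k\,k!}=1\cdot 3\cdot 5\cdots(2k-1),$$ the $2k$-th moment of the standard normal distribution; (iii) $S/\sigma(n)$ is asymptotically normal: it converges in distribution to $N(0,1)$ as $n\to\infty$, and for all real $a\le b$ $$\lim_{n\to\infty}P\bigl(a\,\sigma(n)\le S\le b\,\sigma(n)\bigr)=\frac1{\sqrt{2\pi}}\int_a^b e^{-t^2/2}\,dt .$$ -/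

import Mathlib

open MeasureTheory ProbabilityTheory Filter
open scoped Topology

/-- `S⁺`: the number of pairs of positions `i > j` with `x i > x j`. -/
def scorePlus {n l : ℕ} (x : Fin n → Fin l) : ℕ :=
  (Finset.univ.filter fun ij : Fin n × Fin n => ij.1 > ij.2 ∧ x ij.1 > x ij.2).card

/-- `S⁻`: the number of pairs of positions `i > j` with `x i < x j`. -/
def scoreMinus {n l : ℕ} (x : Fin n → Fin l) : ℕ :=
  (Finset.univ.filter fun ij : Fin n × Fin n => ij.1 > ij.2 ∧ x ij.1 < x ij.2).card

/-- The score `S = S⁺ - S⁻` of a sequence of length `n` of the digits `0, …, l - 1`,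
as a real number. -/
def score {n l : ℕ} (x : Fin n → Fin l) : ℝ :=
  (scorePlus x : ℝ) - (scoreMinus x : ℝ)

/-- The law of a binary sequence of length `n` with independent digits,
each equal to `0` with probability `p` and to `1` with probability `1 - p`. -/
noncomputable def binarySeqMeasure (p : unitInterval) (n : ℕ) : Measure (Fin n → Fin 2) :=
  Measure.pi fun _ => bernoulliMeasure (0 : Fin 2) 1 p

instance (p : unitInterval) (n : ℕ) : IsProbabilityMeasure (binarySeqMeasure p n) := by
  unfold binarySeqMeasure
  infer_instance

/-- The standard deviation `σ(n)` of the score of a random binary sequence of length `n`. -/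
noncomputable def scoreStdDev (p : unitInterval) (n : ℕ) : ℝ :=
  √(variance score (binarySeqMeasure p n))

/-! For two digits, the sign of `x i - x j` is the difference itself, so the score is a linear form
`∑ w_i x_i` in independent digits, with `w_i = 2i - (n - 1)`. Reversing the positions negates the
weights and preserves the law, so odd moments vanish.

The weights sum to zero, so the digits may be standardized: `S/σ = ∑ a_i Z_i`, with `∑ a_i² = 1` for
`n ≥ 2`. As `w_i² ≤ n²` while `∑ w_i²` has order `n³`, `max |a_i| → 0`. The characteristic function
of `Z` agrees with `exp(-t²/2)` to second order, so replacing each factor costs `o(a_i² t²)`, in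
total `o(1)`; Lévy's continuity theorem gives normality.

Bounded digits are sub-Gaussian, and so is `S/σ`, uniformly in `n`. The resulting uniform moment
bounds upgrade weak convergence to convergence of moments. -/

/-! ### Central limit theorem for weighted sums -/

/-- Factors are exchanged one at a time; the remaining ones have norm at most one. -/
lemma norm_prod_sub_prod_le_sum {ι R : Type*} [NormedCommRing R] [NormOneClass R]
    (s : Finset ι) (f g : ι → R) (hf : ∀ i ∈ s, ‖f i‖ ≤ 1) (hg : ∀ i ∈ s, ‖g i‖ ≤ 1) :
    ‖∏ i ∈ s, f i - ∏ i ∈ s, g i‖ ≤ ∑ i ∈ s, ‖f i - g i‖ := by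
  classical
  induction s using Finset.induction_on with
  | empty => simp
  | insert j s hj ih =>
    rw [Finset.prod_insert hj, Finset.prod_insert hj, Finset.sum_insert hj]
    have hP : ‖∏ i ∈ s, f i‖ ≤ 1 :=
      (s.norm_prod_le f).trans
        (Finset.prod_le_one (fun _ _ => norm_nonneg _)
          fun i hi => hf i (Finset.mem_insert_of_mem hi))
    have hgj := hg j (Finset.mem_insert_self j s)
    have ih' := ih (fun i hi => hf i (Finset.mem_insert_of_mem hi))
      (fun i hi => hg i (Finset.mem_insert_of_mem hi))
    calc ‖f j * ∏ i ∈ s, f i - g j * ∏ i ∈ s, g i‖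
        = ‖(f j - g j) * ∏ i ∈ s, f i + g j * (∏ i ∈ s, f i - ∏ i ∈ s, g i)‖ := by
          congr 1; ring
      _ ≤ ‖f j - g j‖ * ‖∏ i ∈ s, f i‖ + ‖g j‖ * ‖∏ i ∈ s, f i - ∏ i ∈ s, g i‖ :=
          (norm_add_le _ _).trans (add_le_add (norm_mul_le _ _) (norm_mul_le _ _))
      _ ≤ ‖f j - g j‖ * 1 + 1 * ∑ i ∈ s, ‖f i - g i‖ := by gcongr
      _ = _ := by ring

lemma isLittleO_exp_neg_sq_div_two :
    (fun t : ℝ => Complex.exp (-(t : ℂ) ^ 2 / 2) - (1 - (t : ℂ) ^ 2 / 2)) =o[𝓝 0]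
      fun t : ℝ => t ^ 2 := by
  have h := (hasDerivAt_iff_isLittleO_nhds_zero.1 (Complex.hasDerivAt_exp 0))
  have ht : Tendsto (fun t : ℝ => -(t : ℂ) ^ 2 / 2) (𝓝 0) (𝓝 0) := by
    have : Continuous fun t : ℝ => -(t : ℂ) ^ 2 / 2 := by fun_prop
    simpa using this.tendsto 0
  have h2 := h.comp_tendsto ht
  have h3 : (fun t : ℝ => -(t : ℂ) ^ 2 / 2) =O[𝓝 0] fun t : ℝ => t ^ 2 := by
    refine Asymptotics.IsBigO.of_bound 1 (Eventually.of_forall fun t => ?_)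
    rw [norm_div, norm_neg, one_mul]
    simp [sq_nonneg]
  refine (h2.trans_isBigO h3).congr_left fun t => ?_
  simp [Function.comp]
  ring

/-- The product of characteristic functions of a triangular array of weighted copies of a
standardized variable converges to the characteristic function of the standard normal law. -/
lemma tendsto_prod_weighted_exp_neg_sq_div_two {φ : ℝ → ℂ} (hφ : ∀ t, ‖φ t‖ ≤ 1)
    (hφ2 : (fun t : ℝ => φ t - (1 - (t : ℂ) ^ 2 / 2)) =o[𝓝 0] fun t : ℝ => t ^ 2)
    {ι : ℕ → Type*} [∀ n, Fintype (ι n)] (a : ∀ n, ι n → ℝ)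
    (hsum : ∀ᶠ n in atTop, ∑ i, a n i ^ 2 = 1)
    (hmax : ∀ ε > 0, ∀ᶠ n in atTop, ∀ i, |a n i| < ε) (t : ℝ) :
    Tendsto (fun n => ∏ i, φ (a n i * t)) atTop (𝓝 (Complex.exp (-(t : ℂ) ^ 2 / 2))) := by
  set ψ : ℝ → ℂ := fun t => Complex.exp (-(t : ℂ) ^ 2 / 2) with hψ
  have hψ1 (s : ℝ) : ‖ψ s‖ ≤ 1 := by
    have : -(s : ℂ) ^ 2 / 2 = ((-s ^ 2 / 2 : ℝ) : ℂ) := by push_cast; ring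
    rw [hψ]
    simp only [this, Complex.norm_exp_ofReal]
    exact Real.exp_le_one_iff.2 (by nlinarith [sq_nonneg s])
  have hd : (fun s : ℝ => φ s - ψ s) =o[𝓝 0] fun s : ℝ => s ^ 2 := by
    refine (hφ2.sub isLittleO_exp_neg_sq_div_two).congr_left fun s => ?_
    simp [hψ]
  rw [Metric.tendsto_atTop']
  intro ε hε
  -- The errors will add up to `ε / (t² + 1) * t² < ε`; the `+ 1` also covers `t = 0`.
  have hδ : 0 < ε / (t ^ 2 + 1) := by positivity
  obtain ⟨δ, hδ0, hδb⟩ := Metric.eventually_nhds_iff.1 (hd.bound hδ)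
  have hev := hsum.and (hmax (δ / (|t| + 1)) (by positivity))
  obtain ⟨N, hN⟩ := eventually_atTop.1 hev
  refine ⟨N, fun n hn => ?_⟩
  obtain ⟨h1, h2⟩ := hN n hn.le
  have hprod : ∏ i, ψ (a n i * t) = Complex.exp (-(t : ℂ) ^ 2 / 2) := by
    rw [hψ]
    simp only
    rw [← Complex.exp_sum]
    congr 1
    have h1' : ∑ i, (a n i : ℂ) ^ 2 = 1 := by exact_mod_cast h1
    calc ∑ i, -((a n i * t : ℝ) : ℂ) ^ 2 / 2 = (∑ i, (a n i : ℂ) ^ 2) * (-(t : ℂ) ^ 2 / 2) := by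
          rw [Finset.sum_mul]
          refine Finset.sum_congr rfl fun i _ => ?_
          push_cast; ring
      _ = _ := by rw [h1', one_mul]
  rw [dist_eq_norm, ← hprod]
  calc ‖∏ i, φ (a n i * t) - ∏ i, ψ (a n i * t)‖
      ≤ ∑ i, ‖φ (a n i * t) - ψ (a n i * t)‖ :=
        norm_prod_sub_prod_le_sum _ _ _ (fun _ _ => hφ _) fun _ _ => hψ1 _
    _ ≤ ∑ i, ε / (t ^ 2 + 1) * (a n i * t) ^ 2 := by
        refine Finset.sum_le_sum fun i _ => ?_
        have hlt : dist (a n i * t) 0 < δ := by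
          rw [dist_zero_right, Real.norm_eq_abs, abs_mul]
          calc |a n i| * |t| ≤ δ / (|t| + 1) * |t| := by gcongr; exact (h2 i).le
            _ < δ := by
              rw [div_mul_eq_mul_div, div_lt_iff₀ (by positivity)]
              nlinarith [abs_nonneg t]
        have := hδb hlt
        rwa [norm_pow, Real.norm_eq_abs, sq_abs] at this
    _ = ε / (t ^ 2 + 1) * t ^ 2 := by
        rw [← Finset.mul_sum]
        simp_rw [mul_pow]
        rw [← Finset.sum_mul, h1, one_mul]
    _ < ε := by
        rw [div_mul_eq_mul_div, div_lt_iff₀ (by positivity)]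
        nlinarith

/-! ### Convergence and bounds of moments -/

/-- Weak convergence implies convergence of the integrals of a nonnegative continuous function
whose second moments are bounded. -/
lemma ProbabilityMeasure.tendsto_integral_of_sq_bounded {Ω : Type*} [TopologicalSpace Ω]
    [MeasurableSpace Ω] [BorelSpace Ω] {μs : ℕ → ProbabilityMeasure Ω}
    {μ : ProbabilityMeasure Ω} (h : Tendsto μs atTop (𝓝 μ)) {f : Ω → ℝ} (hf : Continuous f)
    (hf0 : ∀ x, 0 ≤ f x) {C : ℝ}
    (hint : ∀ n, Integrable (fun x => f x ^ 2) (μs n : Measure Ω))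
    (hC : ∀ n, ∫ x, f x ^ 2 ∂(μs n : Measure Ω) ≤ C)
    (hint' : Integrable (fun x => f x ^ 2) (μ : Measure Ω))
    (hC' : ∫ x, f x ^ 2 ∂(μ : Measure Ω) ≤ C) :
    Tendsto (fun n => ∫ x, f x ∂(μs n : Measure Ω)) atTop (𝓝 (∫ x, f x ∂(μ : Measure Ω))) := by
  have hC0 : 0 ≤ C := (integral_nonneg fun x => sq_nonneg (f x)).trans hC'
  have key (ν : ProbabilityMeasure Ω) (hi : Integrable (fun x => f x ^ 2) (ν : Measure Ω))
      (hb : ∫ x, f x ^ 2 ∂(ν : Measure Ω) ≤ C) {M : ℝ} (hM : 0 < M) :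
      |∫ x, f x ∂(ν : Measure Ω) - ∫ x, min (f x) M ∂(ν : Measure Ω)| ≤ C / M := by
    have hfi : Integrable f (ν : Measure Ω) :=
      ((memLp_two_iff_integrable_sq hf.measurable.aestronglyMeasurable).2 hi).integrable
        one_le_two
    have hmi : Integrable (fun x => min (f x) M) (ν : Measure Ω) :=
      hfi.inf (integrable_const M)
    rw [← integral_sub hfi hmi, abs_of_nonneg
      (integral_nonneg fun x => sub_nonneg.2 (min_le_left _ _))]
    -- The integrand vanishes where `f ≤ M`, and elsewhere `f ≤ f² / M`.
    calc ∫ x, f x - min (f x) M ∂(ν : Measure Ω) ≤ ∫ x, f x ^ 2 / M ∂(ν : Measure Ω) := by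
          refine integral_mono (hfi.sub hmi) (hi.div_const M) fun x => ?_
          simp only
          rw [le_div_iff₀ hM]
          rcases le_total (f x) M with hx | hx
          · rw [min_eq_left hx]; nlinarith [sq_nonneg (f x)]
          · rw [min_eq_right hx]; nlinarith [sq_nonneg (f x), hf0 x, sq_nonneg M]
      _ ≤ C / M := by rw [integral_div]; gcongr
  rw [Metric.tendsto_atTop]
  intro ε hε
  -- Each of the two truncation errors is then below `ε / 3`; `C + 1` keeps `M` positive when `C =
  -- 0`.
  set M : ℝ := 3 * (C + 1) / ε with hMdef
  have hM : 0 < M := by positivity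
  have hCM : C / M < ε / 3 := by
    rw [hMdef, div_lt_iff₀ (by positivity)]
    field_simp
    linarith
  let g : BoundedContinuousFunction Ω ℝ :=
    BoundedContinuousFunction.ofNormedAddCommGroup (fun x => min (f x) M)
      (hf.min continuous_const) M fun x => by
        rw [Real.norm_eq_abs, abs_of_nonneg (le_min (hf0 x) hM.le)]
        exact min_le_right _ _
  obtain ⟨N, hN⟩ := Metric.tendsto_atTop.1
    (ProbabilityMeasure.tendsto_iff_forall_integral_tendsto.1 h g) (ε / 3) (by positivity)
  refine ⟨N, fun n hn => ?_⟩
  have h1 := abs_le.1 (key (μs n) (hint n) (hC n) hM)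
  have h2 := abs_le.1 (key μ hint' hC' hM)
  have h3 : |∫ x, min (f x) M ∂(μs n : Measure Ω) - ∫ x, min (f x) M ∂(μ : Measure Ω)| < ε / 3 :=
    hN n hn
  have h3 := abs_lt.1 h3
  rw [Real.dist_eq, abs_lt]
  constructor <;> linarith [h1.1, h1.2, h2.1, h2.2, h3.1, h3.2]

/-- Since `|x|^m / m! ≤ exp |x| ≤ exp x + exp (-x)`, the generating function at `±1` suffices. The
bound is crude but depends only on `c` and `k`. -/
lemma ProbabilityTheory.HasSubgaussianMGF.integral_pow_two_mul_le {Ω : Type*}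
    {mΩ : MeasurableSpace Ω} {μ : Measure Ω} {X : Ω → ℝ} {c : NNReal}
    (h : HasSubgaussianMGF X c μ) (k : ℕ) :
    Integrable (fun ω => X ω ^ (2 * k)) μ ∧
      ∫ ω, X ω ^ (2 * k) ∂μ ≤ (2 * k).factorial * (2 * Real.exp (c / 2)) := by
  have hp := h.integrable_exp_mul 1
  have hn := h.integrable_exp_mul (-1)
  have hp' := h.mgf_le 1
  have hn' := h.mgf_le (-1)
  simp only [mgf] at hp' hn'
  have hle (ω : Ω) : X ω ^ (2 * k) ≤
      (2 * k).factorial * (Real.exp (1 * X ω) + Real.exp (-1 * X ω)) := by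
    have h1 := Real.pow_div_factorial_le_exp _ (abs_nonneg (X ω)) (2 * k)
    rw [div_le_iff₀ (by positivity), (even_two_mul k).pow_abs] at h1
    have h2 : Real.exp |X ω| ≤ Real.exp (1 * X ω) + Real.exp (-1 * X ω) := by
      rcases abs_choice (X ω) with h | h <;> rw [h] <;> simp [Real.exp_nonneg]
    rw [mul_comm (Real.exp _)] at h1
    exact h1.trans (by gcongr)
  have hbi := (hp.add hn).const_mul ((2 * k).factorial : ℝ)
  have hi : Integrable (fun ω => X ω ^ (2 * k)) μ := by
    refine hbi.mono' (h.aestronglyMeasurable.pow _) (ae_of_all _ fun ω => ?_)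
    rw [Real.norm_eq_abs, abs_of_nonneg ((even_two_mul k).pow_nonneg _)]
    exact hle ω
  refine ⟨hi, (integral_mono hi hbi hle).trans ?_⟩
  rw [integral_const_mul]
  simp only [Pi.add_apply]
  rw [integral_add hp hn]
  norm_num at hp' hn' ⊢
  gcongr
  linarith

lemma hasSubgaussianMGF_id_gaussianReal (v : NNReal) :
    HasSubgaussianMGF (id : ℝ → ℝ) v (gaussianReal 0 v) where
  integrable_exp_mul t := integrable_exp_mul_gaussianReal t
  mgf_le t := by simp [mgf_id_gaussianReal]

/-- The even moments of the standard normal law. -/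
lemma integral_pow_two_mul_gaussianReal_zero_one (k : ℕ) :
    ∫ x, x ^ (2 * k) ∂gaussianReal 0 1 = ((2 * k).factorial : ℝ) / (2 ^ k * (k.factorial : ℝ)) := by
  rw [integral_gaussianReal_eq_integral_smul one_ne_zero]
  have h1 : ∀ x : ℝ, gaussianPDFReal 0 1 x • x ^ (2 * k) =
      (√(2 * Real.pi))⁻¹ * (|x| ^ (2 * k) * Real.exp (-(1 / 2) * |x| ^ 2)) := by
    intro x
    rw [(even_two_mul k).pow_abs, sq_abs, gaussianPDFReal, smul_eq_mul]
    simp only [NNReal.coe_one, mul_one, sub_zero]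
    rw [show -x ^ 2 / 2 = -(1 / 2) * x ^ 2 by ring]
    ring
  simp_rw [h1]
  rw [integral_const_mul,
    integral_comp_abs (f := fun x : ℝ => x ^ (2 * k) * Real.exp (-(1 / 2) * x ^ 2))]
  have h2 := integral_rpow_mul_exp_neg_mul_rpow (p := 2) (q := ((2 * k : ℕ) : ℝ)) (b := 1 / 2)
    (by norm_num) (by linarith [Nat.cast_nonneg (α := ℝ) (2 * k)]) (by norm_num)
  simp only [Real.rpow_natCast, Real.rpow_ofNat] at h2
  rw [h2, show (((2 * k : ℕ) : ℝ) + 1) / 2 = k + 1 / 2 by push_cast; ring,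
    Real.Gamma_nat_add_half,
    show -(((2 * k : ℕ) : ℝ) + 1) / 2 = -(k + 1 / 2) by push_cast; ring,
    one_div (2 : ℝ), Real.inv_rpow (by norm_num), Real.rpow_neg (by norm_num), inv_inv,
    Real.rpow_add (by norm_num), Real.rpow_natCast, ← one_div (2 : ℝ), ← Real.sqrt_eq_rpow,
    Real.sqrt_mul (by norm_num)]
  have h3 : (2 * k).factorial = (2 * k - 1).doubleFactorial * (2 ^ k * k.factorial) := by
    rw [← Nat.doubleFactorial_two_mul]
    -- At `k = 0` the truncated `2 * k - 1` is `0`, and `0‼ = 1`.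
    cases k with
    | zero => rfl
    | succ k =>
      rw [mul_comm (Nat.doubleFactorial _)]
      exact Nat.factorial_eq_mul_doubleFactorial (2 * k + 1)
  rw [h3]
  have : √Real.pi ≠ 0 := by positivity
  push_cast
  field_simp

/-! ### The score as a linear form in the digits -/

lemma score_eq_sum_sum {n : ℕ} (x : Fin n → Fin 2) :
    score x = ∑ i, ∑ j, if j < i then ((x i : ℕ) : ℝ) - ((x j : ℕ) : ℝ) else 0 := by
  have h (a b : Fin 2) : ((if b < a then 1 else 0 : ℝ) - if a < b then 1 else 0) =
      ((a : ℕ) : ℝ) - ((b : ℕ) : ℝ) := by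
    fin_cases a <;> fin_cases b <;> simp
  rw [score, scorePlus, scoreMinus, Finset.card_filter, Finset.card_filter]
  push_cast
  rw [← Finset.sum_sub_distrib, Fintype.sum_prod_type]
  refine Finset.sum_congr rfl fun i _ => Finset.sum_congr rfl fun j _ => ?_
  by_cases hij : j < i
  · simp [hij, ← h]
  · simp [hij]

/-- The weight `2 i - (n - 1)` of the digit in position `i` in the score. -/
def scoreWeight (n : ℕ) (i : Fin n) : ℝ := 2 * ((i : ℕ) : ℝ) - (n - 1)

/-- Position `i` has `i` predecessors, each contributing `+x i`, and `n - 1 - i` successors, each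
contributing `-x i`. -/
lemma score_eq_sum_weight {n : ℕ} (x : Fin n → Fin 2) :
    score x = ∑ i, scoreWeight n i * ((x i : ℕ) : ℝ) := by
  have h1 (i : Fin n) : (∑ j, if j < i then ((x i : ℕ) : ℝ) else 0) =
      ((i : ℕ) : ℝ) * ((x i : ℕ) : ℝ) := by
    rw [← Finset.sum_filter, Finset.filter_gt_eq_Iio, Finset.sum_const, Fin.card_Iio, nsmul_eq_mul]
  have h2 (j : Fin n) : (∑ i, if j < i then ((x j : ℕ) : ℝ) else 0) =
      ((n : ℝ) - 1 - ((j : ℕ) : ℝ)) * ((x j : ℕ) : ℝ) := by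
    rw [← Finset.sum_filter, Finset.filter_lt_eq_Ioi, Finset.sum_const, Fin.card_Ioi, nsmul_eq_mul,
      Nat.sub_sub, Nat.cast_sub (by omega)]
    push_cast; ring
  rw [score_eq_sum_sum]
  have h3 (i j : Fin n) : (if j < i then ((x i : ℕ) : ℝ) - ((x j : ℕ) : ℝ) else 0) =
      (if j < i then ((x i : ℕ) : ℝ) else 0) - if j < i then ((x j : ℕ) : ℝ) else 0 := by
    split_ifs <;> simp
  simp_rw [h3, Finset.sum_sub_distrib, h1]
  rw [Finset.sum_comm]
  simp_rw [h2]
  rw [← Finset.sum_sub_distrib]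
  refine Finset.sum_congr rfl fun i _ => ?_
  rw [scoreWeight]; ring

lemma scoreWeight_rev {n : ℕ} (i : Fin n) : scoreWeight n i.rev = -scoreWeight n i := by
  rw [scoreWeight, scoreWeight, Fin.val_rev, Nat.cast_sub (by omega)]
  push_cast; ring

lemma sum_scoreWeight (n : ℕ) : ∑ i, scoreWeight n i = 0 := by
  have h := Equiv.sum_comp Fin.revPerm (scoreWeight n)
  simp only [Fin.revPerm_apply, scoreWeight_rev, Finset.sum_neg_distrib] at h
  linarith

lemma sum_scoreWeight_sq (n : ℕ) :
    ∑ i, scoreWeight n i ^ 2 = (n : ℝ) * ((n : ℝ) ^ 2 - 1) / 3 := by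
  -- The shift is freed from `n` so that it stays fixed during the induction.
  have h (m : ℝ) : ∑ i ∈ Finset.range n, (2 * (i : ℝ) - m) ^ 2 =
      2 * (n - 1) * n * (2 * n - 1) / 3 - 2 * m * n * (n - 1) + n * m ^ 2 := by
    induction n with
    | zero => simp
    | succ k ih => rw [Finset.sum_range_succ, ih]; push_cast; ring
  simp only [scoreWeight]
  rw [Fin.sum_univ_eq_sum_range (fun i : ℕ => (2 * (i : ℝ) - (n - 1)) ^ 2), h]
  ring

lemma sq_scoreWeight_le {n : ℕ} (i : Fin n) : scoreWeight n i ^ 2 ≤ (n : ℝ) ^ 2 := by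
  have h1 : ((i : ℕ) : ℝ) + 1 ≤ n := by exact_mod_cast i.2
  have h2 : (0 : ℝ) ≤ ((i : ℕ) : ℝ) := by positivity
  rw [scoreWeight]
  apply sq_le_sq'  <;> linarith

/-! ### Reversal symmetry and odd moments -/

lemma score_comp_rev {n : ℕ} (x : Fin n → Fin 2) : score (fun i => x i.rev) = -score x := by
  rw [score_eq_sum_weight, score_eq_sum_weight, ← Finset.sum_neg_distrib,
    ← Equiv.sum_comp Fin.revPerm]
  simp [scoreWeight_rev]

lemma measurePreserving_comp_rev (p : unitInterval) (n : ℕ) :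
    MeasurePreserving (fun (x : Fin n → Fin 2) i => x i.rev)
      (binarySeqMeasure p n) (binarySeqMeasure p n) := by
  have h := measurePreserving_piCongrLeft
    (fun _ : Fin n => bernoulliMeasure (0 : Fin 2) 1 p) Fin.revPerm
  unfold binarySeqMeasure
  convert h using 1
  ext x i
  have := Equiv.piCongrLeft_apply_apply (P := fun _ : Fin n => Fin 2) Fin.revPerm x i.rev
  simp at this
  simp [MeasurableEquiv.coe_piCongrLeft, this]

lemma moment_score_odd (p : unitInterval) (n k : ℕ) :
    moment score (2 * k + 1) (binarySeqMeasure p n) = 0 := by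
  have hm : Measurable fun x : Fin n → Fin 2 => score x ^ (2 * k + 1) := measurable_of_finite _
  have h := (measurePreserving_comp_rev p n).map_eq
  have h2 := integral_map (μ := binarySeqMeasure p n)
    (measurePreserving_comp_rev p n).aemeasurable (f := fun x => score x ^ (2 * k + 1))
    (hm.aestronglyMeasurable)
  rw [h] at h2
  simp only [score_comp_rev, (odd_two_mul_add_one k).neg_pow, integral_neg] at h2
  rw [moment_def]
  simp only [Pi.pow_apply]
  linarith

/-! ### Standardization and variance -/

/-- The digit centered and scaled to mean zero and variance one. -/
noncomputable def standardizedDigit (p : unitInterval) (z : Fin 2) : ℝ :=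
  (((z : ℕ) : ℝ) - (1 - p)) / √(p * (1 - p))

lemma integral_standardizedDigit (p : unitInterval) :
    ∫ z, standardizedDigit p z ∂bernoulliMeasure (0 : Fin 2) 1 p = 0 := by
  rw [integral_bernoulliMeasure]
  simp [standardizedDigit]
  ring

lemma integral_standardizedDigit_sq {p : unitInterval} (hp0 : (0 : ℝ) < p)
    (hp1 : (p : ℝ) < 1) :
    ∫ z, standardizedDigit p z ^ 2 ∂bernoulliMeasure (0 : Fin 2) 1 p = 1 := by
  have h : 0 < (p : ℝ) * (1 - p) := mul_pos hp0 (by linarith)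
  rw [integral_bernoulliMeasure]
  simp only [standardizedDigit, div_pow, Real.sq_sqrt h.le]
  have : (1 - (p : ℝ)) ≠ 0 := by linarith
  simp
  field_simp
  ring

lemma measurable_standardizedDigit (p : unitInterval) : Measurable (standardizedDigit p) :=
  measurable_of_finite _

lemma memLp_standardizedDigit (p : unitInterval) :
    MemLp (standardizedDigit p) 2 (bernoulliMeasure (0 : Fin 2) 1 p) :=
  (memLp_two_iff_integrable_sq (measurable_standardizedDigit p).aestronglyMeasurable).2
    (integrable_bernoulliMeasure _ _ _ _)

lemma score_eq_sum_standardizedDigit {p : unitInterval} (hp0 : (0 : ℝ) < p) (hp1 : (p : ℝ) < 1)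
    {n : ℕ} (x : Fin n → Fin 2) :
    score x = √(p * (1 - p)) * ∑ i, scoreWeight n i * standardizedDigit p (x i) := by
  have h : √((p : ℝ) * (1 - p)) ≠ 0 := (Real.sqrt_pos.2 (mul_pos hp0 (by linarith))).ne'
  rw [Finset.mul_sum, score_eq_sum_weight]
  have h1 (i : Fin n) : √((p : ℝ) * (1 - p)) * (scoreWeight n i * standardizedDigit p (x i)) =
      scoreWeight n i * ((x i : ℕ) : ℝ) - scoreWeight n i * (1 - p) := by
    rw [standardizedDigit]; field_simp
  simp_rw [h1]
  rw [Finset.sum_sub_distrib, ← Finset.sum_mul, sum_scoreWeight, zero_mul, sub_zero]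

lemma variance_score {p : unitInterval} (hp0 : (0 : ℝ) < p) (hp1 : (p : ℝ) < 1) (n : ℕ) :
    variance score (binarySeqMeasure p n) = p * (1 - p) * ∑ i, scoreWeight n i ^ 2 := by
  have h : 0 < (p : ℝ) * (1 - p) := mul_pos hp0 (by linarith)
  have h1 : (score : (Fin n → Fin 2) → ℝ) = fun x => √(p * (1 - p)) *
      (∑ i, fun x : Fin n → Fin 2 => scoreWeight n i * standardizedDigit p (x i)) x := by
    ext x
    rw [score_eq_sum_standardizedDigit hp0 hp1, Finset.sum_apply]
  rw [h1, variance_const_mul, Real.sq_sqrt h.le, binarySeqMeasure,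
    variance_sum_pi (X := fun i z => scoreWeight n i * standardizedDigit p z)
      fun i => (memLp_standardizedDigit p).const_mul _]
  simp_rw [variance_const_mul]
  rw [variance_of_integral_eq_zero (measurable_standardizedDigit p).aemeasurable
    (integral_standardizedDigit p), integral_standardizedDigit_sq hp0 hp1]
  simp

/-- The weights of the score, scaled to have sum of squares one. -/
noncomputable def normalizedWeight (n : ℕ) (i : Fin n) : ℝ :=
  scoreWeight n i / √(∑ j, scoreWeight n j ^ 2)

lemma score_div_scoreStdDev {p : unitInterval} (hp0 : (0 : ℝ) < p) (hp1 : (p : ℝ) < 1) {n : ℕ}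
    (x : Fin n → Fin 2) :
    score x / scoreStdDev p n = ∑ i, normalizedWeight n i * standardizedDigit p (x i) := by
  have h : 0 < (p : ℝ) * (1 - p) := mul_pos hp0 (by linarith)
  rw [scoreStdDev, variance_score hp0 hp1, Real.sqrt_mul h.le,
    score_eq_sum_standardizedDigit hp0 hp1, mul_div_mul_left _ _ (Real.sqrt_pos.2 h).ne',
    Finset.sum_div]
  refine Finset.sum_congr rfl fun i _ => ?_
  rw [normalizedWeight]; ring

lemma sum_scoreWeight_sq_pos {n : ℕ} (hn : 2 ≤ n) : 0 < ∑ i, scoreWeight n i ^ 2 := by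
  have : (2 : ℝ) ≤ n := by exact_mod_cast hn
  rw [sum_scoreWeight_sq]
  have : 0 < (n : ℝ) ^ 2 - 1 := by nlinarith
  positivity

lemma scoreStdDev_pos {p : unitInterval} (hp0 : (0 : ℝ) < p) (hp1 : (p : ℝ) < 1) {n : ℕ}
    (hn : 2 ≤ n) : 0 < scoreStdDev p n := by
  rw [scoreStdDev, variance_score hp0 hp1]
  exact Real.sqrt_pos.2 (mul_pos (mul_pos hp0 (by linarith)) (sum_scoreWeight_sq_pos hn))

lemma normalizedWeight_sq (n : ℕ) (i : Fin n) :
    normalizedWeight n i ^ 2 = scoreWeight n i ^ 2 / ∑ j, scoreWeight n j ^ 2 := by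
  rw [normalizedWeight, div_pow, Real.sq_sqrt (Finset.sum_nonneg fun _ _ => sq_nonneg _)]

lemma sum_normalizedWeight_sq {n : ℕ} (hn : 2 ≤ n) : ∑ i, normalizedWeight n i ^ 2 = 1 := by
  simp_rw [normalizedWeight_sq]
  rw [← Finset.sum_div, div_self (sum_scoreWeight_sq_pos hn).ne']

/-- For `n ≤ 1` the sum is `0`, by the convention `0 / 0 = 0`; the inequality allows sub-Gaussian
bounds for every `n`. -/
lemma sum_normalizedWeight_sq_le (n : ℕ) : ∑ i, normalizedWeight n i ^ 2 ≤ 1 := by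
  simp_rw [normalizedWeight_sq]
  rw [← Finset.sum_div]
  exact div_self_le_one _

lemma eventually_abs_normalizedWeight_lt {ε : ℝ} (hε : 0 < ε) :
    ∀ᶠ n in atTop, ∀ i, |normalizedWeight n i| < ε := by
  -- For `n ≥ 2`, `n² - 1 ≥ n² / 2`, so each squared weight is at most `3n / (n² - 1) ≤ 6 / n`.
  obtain ⟨N, hN⟩ := exists_nat_gt (6 / ε ^ 2)
  filter_upwards [eventually_ge_atTop (max N 2)] with n hn i
  have hn2 : 2 ≤ n := (le_max_right _ _).trans hn
  have h2 : (2 : ℝ) ≤ n := by exact_mod_cast hn2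
  have hNn : (N : ℝ) ≤ n := by exact_mod_cast (le_max_left _ _).trans hn
  have hlt : 6 / ε ^ 2 < n := hN.trans_le hNn
  rw [div_lt_iff₀ (by positivity)] at hlt
  refine abs_lt_of_sq_lt_sq ?_ hε.le
  rw [normalizedWeight_sq, div_lt_iff₀ (sum_scoreWeight_sq_pos hn2), sum_scoreWeight_sq]
  refine (sq_scoreWeight_le i).trans_lt ?_
  have h3 : (n : ℝ) ^ 2 / 2 ≤ (n : ℝ) ^ 2 - 1 := by nlinarith
  calc (n : ℝ) ^ 2 = 6 * ((n : ℝ) ^ 2 / 2) / 3 := by ring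
    _ < (n * ε ^ 2) * ((n : ℝ) ^ 2 / 2) / 3 := by gcongr
    _ ≤ (n * ε ^ 2) * ((n : ℝ) ^ 2 - 1) / 3 := by gcongr
    _ = _ := by ring

/-! ### Convergence in distribution -/

lemma iIndepFun_weighted_standardizedDigit (p : unitInterval) {n : ℕ} (a : Fin n → ℝ) :
    iIndepFun (fun i (x : Fin n → Fin 2) => a i * standardizedDigit p (x i))
      (binarySeqMeasure p n) :=
  iIndepFun_pi (X := fun i z => a i * standardizedDigit p z)
    fun i => ((measurable_standardizedDigit p).const_mul (a i)).aemeasurable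

lemma measurePreserving_digit (p : unitInterval) {n : ℕ} (i : Fin n) :
    MeasurePreserving (fun x : Fin n → Fin 2 => x i) (binarySeqMeasure p n)
      (bernoulliMeasure 0 1 p) :=
  measurePreserving_eval (fun _ : Fin n => bernoulliMeasure (0 : Fin 2) 1 p) i

lemma charFun_weighted_sum_standardizedDigit (p : unitInterval) {n : ℕ} (a : Fin n → ℝ) (t : ℝ) :
    charFun ((binarySeqMeasure p n).map fun x => ∑ i, a i * standardizedDigit p (x i)) t =
      ∏ i, charFun ((bernoulliMeasure (0 : Fin 2) 1 p).map (standardizedDigit p)) (a i * t) := by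
  rw [(iIndepFun_weighted_standardizedDigit p a).charFun_map_fun_sum_eq_prod
    fun i => (measurable_of_finite _).aemeasurable, Finset.prod_apply]
  refine Finset.prod_congr rfl fun i _ => ?_
  rw [charFun_map_mul_comp (measurable_of_finite _).aemeasurable,
    ← (measurePreserving_digit p i).map_eq,
    Measure.map_map (measurable_standardizedDigit p) (measurable_pi_apply i)]
  rfl

lemma tendstoInDistribution_score {p : unitInterval} (hp0 : (0 : ℝ) < p) (hp1 : (p : ℝ) < 1) :
    TendstoInDistribution (fun (n : ℕ) (x : Fin n → Fin 2) => score x / scoreStdDev p n) atTop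
      (id : ℝ → ℝ) (fun n => binarySeqMeasure p n) (gaussianReal 0 1) where
  forall_aemeasurable n := (measurable_of_finite _).aemeasurable
  tendsto := by
    have : IsProbabilityMeasure
        ((bernoulliMeasure (0 : Fin 2) 1 p).map (standardizedDigit p)) :=
      Measure.isProbabilityMeasure_map (measurable_standardizedDigit p).aemeasurable
    refine ProbabilityMeasure.tendsto_iff_tendsto_charFun.2 fun t => ?_
    simp only [ProbabilityMeasure.coe_mk, Measure.map_id, score_div_scoreStdDev hp0 hp1,
      charFun_weighted_sum_standardizedDigit, charFun_gaussianReal]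
    convert tendsto_prod_weighted_exp_neg_sq_div_two (fun t => norm_charFun_le_one t)
      (taylor_charFun_two (measurable_standardizedDigit p).aemeasurable
        (integral_standardizedDigit p) (integral_standardizedDigit_sq hp0 hp1))
      normalizedWeight
      ((eventually_ge_atTop 2).mono fun n hn => sum_normalizedWeight_sq hn)
      (fun ε hε => eventually_abs_normalizedWeight_lt hε) t using 3
    simp [neg_div]

/-! ### Sub-Gaussian bounds and even moments -/

lemma hasSubgaussianMGF_standardizedDigit (p : unitInterval) :
    HasSubgaussianMGF (standardizedDigit p)
      ((‖standardizedDigit p 1 - standardizedDigit p 0‖₊ / 2) ^ 2)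
      (bernoulliMeasure (0 : Fin 2) 1 p) := by
  refine hasSubgaussianMGF_of_mem_Icc_of_integral_eq_zero
    (measurable_standardizedDigit p).aemeasurable (ae_of_all _ fun z => ?_)
    (integral_standardizedDigit p)
  have h : standardizedDigit p 0 ≤ standardizedDigit p 1 := by
    simp only [standardizedDigit]
    gcongr
    simp
  fin_cases z <;> simp [h]

/-- By independence the parameters add up to `∑ a_i² c ≤ c`. -/
lemma hasSubgaussianMGF_score_div_scoreStdDev {p : unitInterval} (hp0 : (0 : ℝ) < p)
    (hp1 : (p : ℝ) < 1) :
    ∃ c : NNReal, ∀ n, ∃ c' ≤ c, HasSubgaussianMGF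
      (fun x : Fin n → Fin 2 => score x / scoreStdDev p n) c' (binarySeqMeasure p n) := by
  set c := (‖standardizedDigit p 1 - standardizedDigit p 0‖₊ / 2) ^ 2
  have hZ {n : ℕ} (i : Fin n) : HasSubgaussianMGF
      (fun x : Fin n → Fin 2 => standardizedDigit p (x i)) c (binarySeqMeasure p n) := by
    have h := hasSubgaussianMGF_standardizedDigit p
    rw [← (measurePreserving_digit p i).map_eq] at h
    exact h.of_map (measurePreserving_digit p i).aemeasurable
  refine ⟨c, fun n => ?_⟩
  have h := HasSubgaussianMGF.sum_of_iIndepFun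
    (iIndepFun_weighted_standardizedDigit p (normalizedWeight n))
    (s := Finset.univ) fun i _ => (hZ i).const_mul (normalizedWeight n i)
  simp only [← score_div_scoreStdDev hp0 hp1] at h
  refine ⟨_, ?_, h⟩
  rw [← NNReal.coe_le_coe, NNReal.coe_sum]
  change ∑ i, normalizedWeight n i ^ 2 * (c : ℝ) ≤ c
  rw [← Finset.sum_mul]
  exact mul_le_of_le_one_left (NNReal.coe_nonneg c) (sum_normalizedWeight_sq_le n)

lemma tendsto_moment_score_even {p : unitInterval} (hp0 : (0 : ℝ) < p) (hp1 : (p : ℝ) < 1)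
    (k : ℕ) :
    Tendsto (fun n : ℕ => moment score (2 * k) (binarySeqMeasure p n) / scoreStdDev p n ^ (2 * k))
      atTop (𝓝 (((2 * k).factorial : ℝ) / (2 ^ k * (k.factorial : ℝ)))) := by
  obtain ⟨c, hc⟩ := hasSubgaussianMGF_score_div_scoreStdDev hp0 hp1
  -- The square of `y ^ (2k)` calls for moments of order `4k`; `max c 1` also covers the Gaussian
  -- limit, of parameter `1`.
  have hb (d : NNReal) (hd : d ≤ max c 1) :
      ((2 * (2 * k)).factorial : ℝ) * (2 * Real.exp (d / 2)) ≤
        (2 * (2 * k)).factorial * (2 * Real.exp ((max c 1 : NNReal) / 2)) := by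
    gcongr
  have hpow (y : ℝ) : (y ^ (2 * k)) ^ 2 = y ^ (2 * (2 * k)) := by ring
  have hm (n : ℕ) : AEMeasurable (fun x : Fin n → Fin 2 => score x / scoreStdDev p n)
      (binarySeqMeasure p n) := (measurable_of_finite _).aemeasurable
  have hg := (hasSubgaussianMGF_id_gaussianReal 1).integral_pow_two_mul_le (2 * k)
  have key := ProbabilityMeasure.tendsto_integral_of_sq_bounded
    (tendstoInDistribution_score hp0 hp1).tendsto (f := fun y : ℝ => y ^ (2 * k))
    (by fun_prop) (fun y => (even_two_mul k).pow_nonneg y)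
    (C := (2 * (2 * k)).factorial * (2 * Real.exp ((max c 1 : NNReal) / 2))) ?_ ?_ ?_ ?_
  · simp only [ProbabilityMeasure.coe_mk, Measure.map_id,
      integral_pow_two_mul_gaussianReal_zero_one] at key
    refine key.congr fun n => ?_
    rw [integral_map (hm n) (by fun_prop), moment_def, ← integral_div]
    simp only [Pi.pow_apply, div_pow]
  · intro n
    obtain ⟨c', -, h⟩ := hc n
    simp only [ProbabilityMeasure.coe_mk, hpow]
    rw [integrable_map_measure (by fun_prop) (hm n)]
    exact (h.integral_pow_two_mul_le (2 * k)).1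
  · intro n
    obtain ⟨c', hc', h⟩ := hc n
    simp only [ProbabilityMeasure.coe_mk, hpow]
    rw [integral_map (hm n) (by fun_prop)]
    exact (h.integral_pow_two_mul_le (2 * k)).2.trans (hb c' (hc'.trans (le_max_left _ _)))
  · simpa only [ProbabilityMeasure.coe_mk, hpow, Measure.map_id, id] using hg.1
  · simp only [ProbabilityMeasure.coe_mk, hpow, Measure.map_id]
    exact hg.2.trans (hb 1 (le_max_right _ _))

/-! ### Probabilities of intervals -/

lemma gaussianReal_zero_one_real_Icc {a b : ℝ} (hab : a ≤ b) :
    (gaussianReal 0 1).real (Set.Icc a b) =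
      (√(2 * Real.pi))⁻¹ * ∫ t in a..b, Real.exp (-t ^ 2 / 2) := by
  rw [measureReal_def, gaussianReal_apply_eq_integral 0 one_ne_zero, ENNReal.toReal_ofReal
    (integral_nonneg fun x => gaussianPDFReal_nonneg 0 1 x), integral_Icc_eq_integral_Ioc,
    ← intervalIntegral.integral_of_le hab, ← intervalIntegral.integral_const_mul]
  simp [gaussianPDFReal]

lemma tendsto_measureReal_score_mem_Icc {p : unitInterval} (hp0 : (0 : ℝ) < p)
    (hp1 : (p : ℝ) < 1) {a b : ℝ} (hab : a ≤ b) :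
    Tendsto (fun n : ℕ => (binarySeqMeasure p n).real
        {x | a * scoreStdDev p n ≤ score x ∧ score x ≤ b * scoreStdDev p n})
      atTop (𝓝 ((√(2 * Real.pi))⁻¹ * ∫ t in a..b, Real.exp (-t ^ 2 / 2))) := by
  have hnull : NullSingletonClass (gaussianReal 0 1) := nullSingletonClass_gaussianReal one_ne_zero
  have h := ProbabilityMeasure.tendsto_measure_of_null_frontier_of_tendsto'
    (tendstoInDistribution_score hp0 hp1).tendsto (E := Set.Icc a b) (by
      rw [frontier_Icc hab, ProbabilityMeasure.coe_mk, Measure.map_id]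
      exact (Set.toFinite {a, b}).measure_zero _)
  simp only [ProbabilityMeasure.coe_mk, Measure.map_id] at h
  have h2 := (ENNReal.tendsto_toReal (measure_ne_top _ _)).comp h
  rw [← gaussianReal_zero_one_real_Icc hab]
  refine h2.congr' ?_
  -- From `n = 2` on, `σ(n) > 0`, so the inequalities may be divided by it.
  filter_upwards [eventually_ge_atTop 2] with n hn
  have hσ := scoreStdDev_pos hp0 hp1 hn
  simp only [Function.comp]
  rw [Measure.map_apply (measurable_of_finite _) measurableSet_Icc, measureReal_def]
  congr 2
  ext x
  simp [le_div_iff₀ hσ, div_le_iff₀ hσ]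

theorem mainTheorem5 (p : unitInterval) (hp0 : (0 : ℝ) < p) (hp1 : (p : ℝ) < 1)
    (hpq : (p : ℝ) ≠ 1 - p) :
    -- all odd moments vanish
    (∀ n k : ℕ, moment score (2 * k + 1) (binarySeqMeasure p n) = 0) ∧
    -- the normalized even moments converge to those of the standard normal distribution
    (∀ k : ℕ, Tendsto
      (fun n : ℕ => moment score (2 * k) (binarySeqMeasure p n) / scoreStdDev p n ^ (2 * k))
      atTop (𝓝 (((2 * k).factorial : ℝ) / (2 ^ k * (k.factorial : ℝ))))) ∧
    -- the normalized score converges in distribution to a standard normal variable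
    TendstoInDistribution
      (fun (n : ℕ) (x : Fin n → Fin 2) => score x / scoreStdDev p n) atTop
      (id : ℝ → ℝ) (fun n => binarySeqMeasure p n) (gaussianReal 0 1) ∧
    -- the frequency of scores between two multiples of the standard deviation
    (∀ a b : ℝ, a ≤ b → Tendsto
      (fun n : ℕ => (binarySeqMeasure p n).real
        {x | a * scoreStdDev p n ≤ score x ∧ score x ≤ b * scoreStdDev p n})
      atTop (𝓝 ((√(2 * Real.pi))⁻¹ * ∫ t in a..b, Real.exp (-t ^ 2 / 2)))) :=
  ⟨moment_score_odd p, tendsto_moment_score_even hp0 hp1, tendstoInDistribution_score hp0 hp1,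
    fun _ _ hab => tendsto_measureReal_score_mem_Icc hp0 hp1 hab⟩
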